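/- **Setting.** Let $K\ge 1$, $[K]=\{1,\dots,K\}$, let $X\in[K]$, $W\in\{0,1\}$ and $U\in\mathbb R$ be random variables on a probability space, let $g:[K]\to\mathbb R$ (identified with a vector in $\mathbb R^K$), and let $Y=g(X)+U$. Write $p_k(\ell)=\mathbb P(X=k\mid W=\ell)$. Assume: 1. (Relevance) $\mathbb P(X\in J\mid W=0)\neq \mathbb P(X\in J\mid W=1)$ for every nonempty $J\subsetneq [K]$. 2. $\mathbb E|U|^m<\infty$ for all $m\le K+1$, $\mathbb E[U]=0$, and $\mathbb E[U^m\mid W=\ell]=\mathbb E[U^m]$ for $m=1,\dots,K+1$ and $\ell\in\{0,1\}$. 3. For all $\ell\in\{0,1\}$, $k\in[K]$ the conditional law of $U$ given $W=\ell,X=k$ (which is taken to be defined, i.e. $\mathbb P(W=\ell,X=k)>0$) has at least $\lfloor (K-1)/2\rfloor+1$ points in its support. Let $S_{K-1}$ be the family of lower conditional moments $\mathbb E[U^m\mid W=\ell,X=k]$, $\ell\in\{0,1\}$, $k\in[K]$, $1\le m\le K-1$. Index the coordinates of $\mathbb R^{2K}$ by pairs $(\ell,k)$, and let $$H=\Big\{v\in\mathbb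 R^{2K}:\ \sum_{k=1}^K p_k(0)v_{0,k}=\sum_{k=1}^K p_k(1)v_{1,k}\Big\}.$$ Say that probability laws $(\nu_{\ell,k})$ on $\mathbb R$ *extend $S_{K-1}$ with $K$-th moments $v$* if they have finite absolute moments up to order $K$, $\int x^m\,d\nu_{\ell,k}=\mathbb E[U^m\mid W=\ell,X=k]$ for $1\le m\le K-1$, and $\int x^K\,d\nu_{\ell,k}=v_{\ell,k}$, for all $\ell,k$. Let $T$ be the set of $v\in H$ for which such laws exist. Let $A(S_{K-1})$ be the set of vectors $\delta=g-h$, $h\in\mathbb R^K$, such that $\mathbb E[g(X)-h(X)]=0$ and $$\sum_{k=1}^K\Big[p_k(0)\,\mathbb E[(Y-h_k)^m\mid W=0,X=k]-p_k(1)\,\mathbb E[(Y-h_k)^m\mid W=1,X=k]\Big]=0,\qquad m=1,\dots,K .$$ Let $T_0\subset T$ be the set of $v\in T$ for which moments up to order $K+1$ do not point identify $g$: there exist laws $(\nu_{\ell,k})$ extending $S_{K-1}$ with $K$-th moments $v$, with finite absolute moments of order $K+1$ and with $\sum_k p_k(0)\int x^m\,d\nu_{0,k}=\sum_k p_k(1)\int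 x^m\,d\nu_{1,k}$ for $m=1,\dots,K+1$, and there exists $0\ne\delta\in A(S_{K-1})$ with $\mathbb E[\delta(X)]=0$ and $$\sum_{k=1}^K\Big[p_k(0)\int (x+\delta_k)^m\,d\nu_{0,k}-p_k(1)\int (x+\delta_k)^m\,d\nu_{1,k}\Big]=0,\qquad m=1,\dots,K+1 .$$ **Proposition.** $T_0$ is contained in a finite union of affine subspaces of $\mathbb R^{2K}$, each of dimension strictly smaller than the dimension of (the affine hull of) $T$. The set $T$ has nonempty interior in the hyperplane $H$ (with its relative topology). In particular, $T$ is a measurable subset of $H$, and every Haar measure $\mu$ on $H$ satisfies $\mu(T)=\infty$ and $\mu(T_0)=0$. -/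

import Mathlib

open MeasureTheory ProbabilityTheory

namespace BinaryIV

noncomputable section

/-- `p_k(ℓ) = P(X = k | W = ℓ)`. -/
def condProb {Ω : Type*} [MeasurableSpace Ω] (P : Measure Ω) {K : ℕ}
    (X : Ω → Fin K) (W : Ω → Fin 2) (ℓ : Fin 2) (k : Fin K) : ℝ :=
  (P[|{ω | W ω = ℓ}]).real {ω | X ω = k}

/-- The conditional expectation `E[Z | W = ℓ, X = k]`. -/
def condExpWX {Ω : Type*} [MeasurableSpace Ω] (P : Measure Ω) {K : ℕ}
    (X : Ω → Fin K) (W : Ω → Fin 2) (Z : Ω → ℝ) (ℓ : Fin 2) (k : Fin K) : ℝ :=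
  ∫ ω, Z ω ∂(P[|{ω | W ω = ℓ ∧ X ω = k}])

/-- The conditional expectation `E[Z | W = ℓ]`. -/
def condExpW {Ω : Type*} [MeasurableSpace Ω] (P : Measure Ω)
    (W : Ω → Fin 2) (Z : Ω → ℝ) (ℓ : Fin 2) : ℝ :=
  ∫ ω, Z ω ∂(P[|{ω | W ω = ℓ}])

/-- The conditional law of `U` given `W = ℓ, X = k`.  When the conditioning event is null,
this is the zero measure, whose support is empty. -/
def condLaw {Ω : Type*} [MeasurableSpace Ω] (P : Measure Ω) {K : ℕ}
    (X : Ω → Fin K) (W : Ω → Fin 2) (U : Ω → ℝ) (ℓ : Fin 2) (k : Fin K) : Measure ℝ :=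
  (P[|{ω | W ω = ℓ ∧ X ω = k}]).map U

/-- Relevance of the instrument: `P(X ∈ J | W = 0) ≠ P(X ∈ J | W = 1)` for every nonempty strict
subset `J` of the range of `X` (for empty `J` both sides vanish). -/
def Relevant {Ω : Type*} [MeasurableSpace Ω] (P : Measure Ω) {K : ℕ}
    (X : Ω → Fin K) (W : Ω → Fin 2) : Prop :=
  ∀ J : Set (Fin K), J.Nonempty → J ≠ Set.univ →
    (P[|{ω | W ω = 0}]).real {ω | X ω ∈ J} ≠ (P[|{ω | W ω = 1}]).real {ω | X ω ∈ J}

/-- The hyperplane of `ℝ^{2K}` given by `∑ p_k(0) v_{0,k} = ∑ p_k(1) v_{1,k}`. The coordinates of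
`ℝ^{2K}` are indexed by pairs `(ℓ, k)`. -/
def hyperplane {Ω : Type*} [MeasurableSpace Ω] (P : Measure Ω) {K : ℕ}
    (X : Ω → Fin K) (W : Ω → Fin 2) : Submodule ℝ (Fin 2 × Fin K → ℝ) where
  carrier := {v | ∑ k, condProb P X W 0 k * v (0, k) = ∑ k, condProb P X W 1 k * v (1, k)}
  add_mem' := by
    intro a b ha hb
    simp only [Set.mem_ofPred_eq, Pi.add_apply, mul_add, Finset.sum_add_distrib] at *
    rw [ha, hb]
  zero_mem' := by simp
  smul_mem' := by
    intro c v hv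
    simp only [Set.mem_ofPred_eq, Pi.smul_apply, smul_eq_mul, mul_left_comm _ c,
      ← Finset.mul_sum] at *
    rw [hv]

/-- The set `A(S_{K-1})` of all `δ = g - h`, where `h` solves, for `Y = g(X) + U`, the equations
`∑_k (p_k(0) E[(Y - h_k)^m | W = 0, X = k] - p_k(1) E[(Y - h_k)^m | W = 1, X = k]) = 0`
for `m = 1, …, K`, and `E[g(X) - h(X)] = 0`.  (On `X = k` one has `Y - h_k = U + δ_k`.) -/
def solutionSet {Ω : Type*} [MeasurableSpace Ω] (P : Measure Ω) {K : ℕ}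
    (X : Ω → Fin K) (W : Ω → Fin 2) (U : Ω → ℝ) (g : Fin K → ℝ) : Set (Fin K → ℝ) :=
  {δ | ∃ h : Fin K → ℝ, δ = g - h ∧
    (∀ m ∈ Finset.Icc 1 K,
      ∑ k, (condProb P X W 0 k * condExpWX P X W (fun ω => (g (X ω) + U ω - h k) ^ m) 0 k
        - condProb P X W 1 k * condExpWX P X W (fun ω => (g (X ω) + U ω - h k) ^ m) 1 k) = 0) ∧
    ∫ ω, (g (X ω) - h (X ω)) ∂P = 0}

/-- The probability laws `ν ℓ k` (of random variables `V_{ℓ,k}`) have the same moments of order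
`1, …, K - 1` as `U` given `W = ℓ, X = k`, and `K`-th moments `v`. -/
structure Extends {Ω : Type*} [MeasurableSpace Ω] (P : Measure Ω) {K : ℕ}
    (X : Ω → Fin K) (W : Ω → Fin 2) (U : Ω → ℝ) (v : Fin 2 × Fin K → ℝ)
    (ν : Fin 2 → Fin K → Measure ℝ) : Prop where
  isProbabilityMeasure : ∀ ℓ k, IsProbabilityMeasure (ν ℓ k)
  integrable : ∀ ℓ k, ∀ m ≤ K, Integrable (fun x : ℝ => x ^ m) (ν ℓ k)
  lower_moments : ∀ ℓ k, ∀ m ∈ Finset.Icc 1 (K - 1),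
    ∫ x, x ^ m ∂(ν ℓ k) = condExpWX P X W (fun ω => U ω ^ m) ℓ k
  top_moment : ∀ ℓ k, ∫ x, x ^ K ∂(ν ℓ k) = v (ℓ, k)

/-- The set `T` of admissible vectors of conditional `K`-th moments. -/
def admissible {Ω : Type*} [MeasurableSpace Ω] (P : Measure Ω) {K : ℕ}
    (X : Ω → Fin K) (W : Ω → Fin 2) (U : Ω → ℝ) : Set (Fin 2 × Fin K → ℝ) :=
  {v | v ∈ hyperplane P X W ∧ ∃ ν : Fin 2 → Fin K → Measure ℝ, Extends P X W U v ν}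

/-- The set `T_0` of those `v ∈ T` for which moments up to order `K + 1` do not point identify `g`:
for some conditional laws `ν ℓ k` that extend the lower moments with `K`-th moments `v`, have finite
moments of order `K + 1`, and have moments independent of `W` up to order `K + 1`, there is a
nonzero `δ ∈ A(S_{K-1})` such that the moments of `U + δ(X)` up to order `K + 1`
are independent of `W` as well, and `E[δ(X)] = 0`. -/
def nonIdentified {Ω : Type*} [MeasurableSpace Ω] (P : Measure Ω) {K : ℕ}
    (X : Ω → Fin K) (W : Ω → Fin 2) (U : Ω → ℝ) (g : Fin K → ℝ) :
    Set (Fin 2 × Fin K → ℝ) :=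
  {v | v ∈ admissible P X W U ∧ ∃ ν : Fin 2 → Fin K → Measure ℝ, Extends P X W U v ν ∧
    (∀ ℓ k, Integrable (fun x : ℝ => x ^ (K + 1)) (ν ℓ k)) ∧
    (∀ m ∈ Finset.Icc 1 (K + 1),
      ∑ k, condProb P X W 0 k * ∫ x, x ^ m ∂(ν 0 k)
        = ∑ k, condProb P X W 1 k * ∫ x, x ^ m ∂(ν 1 k)) ∧
    ∃ δ ∈ solutionSet P X W U g, δ ≠ 0 ∧
      (∀ m ∈ Finset.Icc 1 (K + 1),
        ∑ k, (condProb P X W 0 k * ∫ x, (x + δ k) ^ m ∂(ν 0 k)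
          - condProb P X W 1 k * ∫ x, (x + δ k) ^ m ∂(ν 1 k)) = 0) ∧
      ∫ ω, δ (X ω) ∂P = 0}

end

end BinaryIV

/-!
The coordinates of `T` are independent apart from the equation of the hyperplane `H`: for each
`(ℓ, k)` the possible `K`-th moments form an interval, because laws can be mixed. So `T` is
measurable. By `exists_measure_moments_of_integral_lt` each interval contains everything above the
true `K`-th moment: otherwise the Hahn-Banach theorem separates the desired moment vector from the
cone of moment vectors by a nonzero polynomial `p ≥ 0` of degree at most `K`. If the degree is `K`,
then its leading coefficient is positive, and raising the `K`-th moment of the true law makes the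
functional positive. If it is smaller, then the support condition makes the true mean of `p`
positive, as a nonnegative polynomial has at most `deg p / 2` distinct zeros. Since `H` contains the constant vector `1`, the set `T` contains balls of `H` of
every radius, which gives the nonempty interior and the infinite Haar measure.

For `T₀`, expand the moment of order `K + 1` of `U + δ(X)`. The terms of order `K + 1` cancel, those
of order `K` give the linear functional `topMomentFunctional` of `v`, and the others are
determined by `S_{K-1}`. So every `δ` confines `v` to the solutions in `H` of one affine equation,
which is nontrivial on `H` because `δ` is not constant (`hyperplane_inf_ker_lt`).
Finitely many `δ` occur: the leading forms of the equations that define `A(S_{K-1})` are power sums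
with weights `p_k(0) - p_k(1)`, and relevance implies that they vanish simultaneously, over `ℂ` too,
at constant vectors only (`eq_of_weighted_power_sums_eq_zero`). Together with `E[δ(X)] = 0` this
leaves the origin, and a polynomial system whose leading forms have no other common zero has
finitely many solutions (`MvPolynomial.finite_zeros_of_leadingForms`).
-/

/-! ### Nonnegative polynomials and moment cones -/

/-- A nonnegative real polynomial vanishes to order at least two at each of its zeros, so it has at
most `natDegree / 2` distinct zeros. -/
theorem Polynomial.two_mul_card_le_natDegree_of_nonneg {p : Polynomial ℝ} (hp : p ≠ 0)
    (h0 : ∀ x, 0 ≤ p.eval x) (S : Finset ℝ) (hS : ∀ s ∈ S, p.eval s = 0) :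
    2 * S.card ≤ p.natDegree := by
  have hmult : ∀ s ∈ S, 2 ≤ p.roots.count s := by
    intro s hs
    rw [Polynomial.count_roots]
    refine (Polynomial.one_lt_rootMultiplicity_iff_isRoot hp).2 ⟨hS s hs, ?_⟩
    have hmin : IsLocalMin (fun x => p.eval x) s :=
      Filter.Eventually.of_forall fun x => by simpa [hS s hs] using h0 x
    have := hmin.deriv_eq_zero
    rwa [Polynomial.deriv] at this
  calc 2 * S.card = ∑ s ∈ S, 2 := by simp [mul_comm]
    _ ≤ ∑ s ∈ S, p.roots.count s := Finset.sum_le_sum hmult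
    _ ≤ ∑ s ∈ p.roots.toFinset, p.roots.count s := by
        refine Finset.sum_le_sum_of_subset fun s hs => ?_
        simpa [hp] using hS s hs
    _ = p.roots.card := Multiset.toFinset_sum_count_eq _
    _ ≤ p.natDegree := p.card_roots'

theorem Polynomial.integrable_eval_of_integrable_pow {μ : Measure ℝ} {d : ℕ}
    (hint : ∀ m ≤ d, Integrable (fun x : ℝ => x ^ m) μ) {p : Polynomial ℝ}
    (hp : p.natDegree ≤ d) : Integrable (fun x => p.eval x) μ := by
  simp_rw [Polynomial.eval_eq_sum_range]
  exact integrable_finsetSum _ fun i hi =>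
    (hint i (by have := Finset.mem_range.1 hi; omega)).const_mul _

/-- If the support of `μ` has more than `natDegree p / 2` points, then the nonnegative polynomial
`p` cannot vanish on it. -/
theorem Polynomial.integral_eval_pos_of_nonneg {μ : Measure ℝ} {d : ℕ}
    (hint : ∀ m ≤ d, Integrable (fun x : ℝ => x ^ m) μ)
    (hs : ((d / 2 + 1 : ℕ) : ℕ∞) ≤ μ.support.encard)
    {p : Polynomial ℝ} (hp : p ≠ 0) (hd : p.natDegree ≤ d) (h0 : ∀ x, 0 ≤ p.eval x) :
    0 < ∫ x, p.eval x ∂μ := by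
  refine lt_of_le_of_ne (integral_nonneg h0) fun h => ?_
  have hae := (integral_eq_zero_iff_of_nonneg h0
    (Polynomial.integrable_eval_of_integrable_pow hint hd)).1 h.symm
  have hsub : μ.support ⊆ {x | p.eval x = 0} :=
    Measure.support_subset_of_isClosed (isClosed_eq p.continuous continuous_const) hae
  obtain ⟨S, hSsub, hScard⟩ := Set.exists_subset_encard_eq hs
  have hfin : S.Finite := Set.finite_of_encard_eq_coe hScard
  have hcard : hfin.toFinset.card = d / 2 + 1 := by
    rw [hfin.encard_eq_coe_toFinset_card] at hScard
    exact_mod_cast hScard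
  have := Polynomial.two_mul_card_le_natDegree_of_nonneg hp h0 hfin.toFinset
    fun s hs => hsub (hSsub (hfin.mem_toFinset.1 hs))
  omega

/-- The coefficient of order `d` of a nonnegative polynomial of degree at most `d` is nonnegative. -/
theorem Polynomial.coeff_nonneg_of_nonneg {p : Polynomial ℝ} {d : ℕ} (hd : p.natDegree ≤ d)
    (h0 : ∀ x, 0 ≤ p.eval x) : 0 ≤ p.coeff d := by
  rcases hd.lt_or_eq with hlt | rfl
  · rw [Polynomial.coeff_eq_zero_of_natDegree_lt hlt]
  · by_contra! hneg
    rcases Nat.eq_zero_or_pos p.natDegree with hz | hpos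
    · have := h0 0
      rw [← Polynomial.coeff_zero_eq_eval_zero] at this
      rw [hz] at hneg
      linarith
    · have ht := p.tendsto_atBot_of_leadingCoeff_nonpos (Polynomial.natDegree_pos_iff_degree_pos.1 hpos)
        hneg.le
      obtain ⟨x, hx⟩ := (ht.eventually (Filter.eventually_lt_atBot 0)).exists
      exact absurd (h0 x) (not_le.2 hx)

/-- The cone of vectors `(∫ x ^ i ∂ν)_{i ≤ d}` of moments of finite measures `ν` on `ℝ` all of whose
moments exist. -/
def momentCone (d : ℕ) : Set (Fin (d + 1) → ℝ) :=
  {w | ∃ ν : Measure ℝ, IsFiniteMeasure ν ∧ (∀ m : ℕ, Integrable (fun x : ℝ => x ^ m) ν) ∧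
    ∀ i : Fin (d + 1), ∫ x, x ^ (i : ℕ) ∂ν = w i}

theorem momentCone_smul_mem {d : ℕ} {w : Fin (d + 1) → ℝ} (hw : w ∈ momentCone d) {a : ℝ}
    (ha : 0 ≤ a) : a • w ∈ momentCone d := by
  obtain ⟨ν, hν, hi, hm⟩ := hw
  refine ⟨ENNReal.ofReal a • ν, Measure.smul_finite _ ENNReal.ofReal_ne_top,
    fun m => (hi m).smul_measure ENNReal.ofReal_ne_top, fun i => ?_⟩
  rw [integral_smul_measure, hm, ENNReal.toReal_ofReal ha, Pi.smul_apply]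

theorem momentCone_add_mem {d : ℕ} {w z : Fin (d + 1) → ℝ} (hw : w ∈ momentCone d)
    (hz : z ∈ momentCone d) : w + z ∈ momentCone d := by
  obtain ⟨ν, hν, hi, hm⟩ := hw
  obtain ⟨ν', hν', hi', hm'⟩ := hz
  refine ⟨ν + ν', inferInstance, fun m => (hi m).add_measure (hi' m), fun i => ?_⟩
  rw [integral_add_measure (hi _) (hi' _), hm, hm', Pi.add_apply]

theorem pow_mem_momentCone (d : ℕ) (x : ℝ) : (fun i : Fin (d + 1) => x ^ (i : ℕ)) ∈ momentCone d :=
  ⟨Measure.dirac x, inferInstance, fun m => integrable_dirac (by simp), fun i => by simp⟩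

theorem convex_momentCone (d : ℕ) : Convex ℝ (momentCone d) :=
  fun _ hw _ hz _ _ ha hb _ =>
    momentCone_add_mem (momentCone_smul_mem hw ha) (momentCone_smul_mem hz hb)

/-- The polynomial whose coefficients represent a linear functional on `ℝ^{d+1}`; its value at `x`
is the value of the functional on the moment curve `(1, x, …, x ^ d)`. -/
noncomputable def dualPolynomial {d : ℕ} (f : (Fin (d + 1) → ℝ) →ₗ[ℝ] ℝ) : Polynomial ℝ :=
  ∑ i : Fin (d + 1), Polynomial.monomial (i : ℕ) (f (Pi.single i 1))

theorem LinearMap.apply_eq_sum_pi_single {ι : Type*} [Fintype ι] [DecidableEq ι]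
    (f : (ι → ℝ) →ₗ[ℝ] ℝ) (w : ι → ℝ) : f w = ∑ i, w i * f (Pi.single i 1) := by
  conv_lhs => rw [pi_eq_sum_univ' w]
  simp

theorem eval_dualPolynomial {d : ℕ} (f : (Fin (d + 1) → ℝ) →ₗ[ℝ] ℝ) (x : ℝ) :
    (dualPolynomial f).eval x = f fun i => x ^ (i : ℕ) := by
  rw [f.apply_eq_sum_pi_single, dualPolynomial, Polynomial.eval_finsetSum]
  simp [Polynomial.eval_monomial, mul_comm]

theorem coeff_dualPolynomial {d : ℕ} (f : (Fin (d + 1) → ℝ) →ₗ[ℝ] ℝ) (i : Fin (d + 1)) :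
    (dualPolynomial f).coeff i = f (Pi.single i 1) := by
  simp [dualPolynomial, Polynomial.coeff_monomial, Fin.val_inj]

theorem natDegree_dualPolynomial_le {d : ℕ} (f : (Fin (d + 1) → ℝ) →ₗ[ℝ] ℝ) :
    (dualPolynomial f).natDegree ≤ d :=
  Polynomial.natDegree_sum_le_of_forall_le _ _ fun i _ =>
    (Polynomial.natDegree_monomial_le _).trans (by omega)

theorem dualPolynomial_ne_zero {d : ℕ} {f : (Fin (d + 1) → ℝ) →ₗ[ℝ] ℝ} (hf : f ≠ 0) :
    dualPolynomial f ≠ 0 := by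
  contrapose! hf
  ext i
  simpa [hf] using (coeff_dualPolynomial f i).symm

theorem interior_momentCone_nonempty (d : ℕ) : (interior (momentCone d)).Nonempty := by
  rw [(convex_momentCone d).interior_nonempty_iff_affineSpan_eq_top]
  have h0 : (0 : Fin (d + 1) → ℝ) ∈ momentCone d := by
    simpa using momentCone_smul_mem (pow_mem_momentCone d 0) le_rfl
  have hspan : Submodule.span ℝ (momentCone d) = ⊤ := by
    by_contra hne
    obtain ⟨f, hf, hle⟩ := Submodule.exists_le_ker_of_lt_top _ (lt_top_iff_ne_top.2 hne)
    refine dualPolynomial_ne_zero hf (Polynomial.funext fun x => ?_)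
    rw [eval_dualPolynomial, Polynomial.eval_zero]
    exact hle (Submodule.subset_span (pow_mem_momentCone d x))
  rw [AffineSubspace.affineSpan_eq_top_iff_vectorSpan_eq_top_of_nonempty _ _ _ ⟨0, h0⟩, eq_top_iff, ← hspan,
    Submodule.span_le]
  intro w hw
  simpa using vsub_mem_vectorSpan ℝ hw h0

/-- A vector outside the moment cone is separated from it by a nonzero polynomial that is
nonnegative on `ℝ`. -/
theorem exists_functional_of_notMem_momentCone {d : ℕ} {w : Fin (d + 1) → ℝ}
    (hw : w ∉ momentCone d) :
    ∃ f : (Fin (d + 1) → ℝ) →ₗ[ℝ] ℝ, f ≠ 0 ∧ (∀ x, 0 ≤ (dualPolynomial f).eval x) ∧ f w ≤ 0 := by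
  obtain ⟨f, hf⟩ := geometric_hahn_banach_point_open (convex_momentCone d).interior
    isOpen_interior (fun h => hw (interior_subset h))
  obtain ⟨z, hz⟩ := interior_momentCone_nonempty d
  have hcone : ∀ c ∈ momentCone d, f w ≤ f c := by
    intro c hc
    have hcl : c ∈ closure (interior (momentCone d)) := by
      rw [(convex_momentCone d).closure_interior_eq_closure_of_nonempty_interior ⟨z, hz⟩]
      exact subset_closure hc
    have hclosed : IsClosed {y | f w ≤ f y} := isClosed_le continuous_const f.continuous
    exact closure_minimal (fun y hy => (hf y hy).le) hclosed hcl
  refine ⟨f.toLinearMap, ?_, fun x => ?_, ?_⟩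
  · intro h
    have h1 : ∀ y, f y = 0 := fun y => by simpa using LinearMap.congr_fun h y
    have := hf z hz
    simp [h1] at this
  · rw [eval_dualPolynomial]
    -- A negative value of `f` on a ray of the cone would make `f` unbounded below on the cone.
    by_contra! hneg
    set y : Fin (d + 1) → ℝ := fun i => x ^ (i : ℕ)
    change f y < 0 at hneg
    have hmem := momentCone_smul_mem (pow_mem_momentCone d x)
      (a := (|f w| + 1) / (-f y)) (by apply div_nonneg <;> [positivity; linarith])
    have h := hcone _ hmem
    rw [map_smul, smul_eq_mul, div_mul_eq_mul_div, le_div_iff₀ (by linarith)] at h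
    nlinarith [neg_abs_le (f w)]
  · simpa using hcone _ (momentCone_smul_mem (pow_mem_momentCone d 0) le_rfl)

/-- The moment extension theorem: the lower moments of a law with sufficiently many points in its
support can be kept while the moment of order `K` is increased arbitrarily. -/
theorem exists_measure_moments_of_integral_lt {μ : Measure ℝ} [IsProbabilityMeasure μ] {K : ℕ}
    (hK : 1 ≤ K) (hint : ∀ m ≤ K, Integrable (fun x : ℝ => x ^ m) μ)
    (hs : (((K - 1) / 2 + 1 : ℕ) : ℕ∞) ≤ μ.support.encard) {v : ℝ} (hv : ∫ x, x ^ K ∂μ < v) :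
    ∃ ν : Measure ℝ, IsProbabilityMeasure ν ∧ (∀ m : ℕ, Integrable (fun x : ℝ => x ^ m) ν) ∧
      (∀ m < K, ∫ x, x ^ m ∂ν = ∫ x, x ^ m ∂μ) ∧ ∫ x, x ^ K ∂ν = v := by
  set w : Fin (K + 1) → ℝ := fun i => ∫ x, x ^ (i : ℕ) ∂μ with hw
  set u : Fin (K + 1) → ℝ := w + Pi.single (Fin.last K) (v - ∫ x, x ^ K ∂μ) with hu
  have hmem : u ∈ momentCone K := by
    by_contra hnot
    obtain ⟨f, hf0, hpos, hfu⟩ := exists_functional_of_notMem_momentCone hnot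
    set p := dualPolynomial f with hp
    have hdeg : p.natDegree ≤ K := natDegree_dualPolynomial_le f
    have hfw : f w = ∫ x, p.eval x ∂μ := by
      have heval : ∀ x, p.eval x = ∑ i : Fin (K + 1), x ^ (i : ℕ) * f (Pi.single i 1) :=
        fun x => by rw [hp, eval_dualPolynomial, f.apply_eq_sum_pi_single]
      simp_rw [heval]
      rw [f.apply_eq_sum_pi_single, integral_finsetSum _ fun (i : Fin (K + 1)) _ =>
        (hint (i : ℕ) (Nat.lt_succ_iff.1 i.2)).mul_const (f (Pi.single i 1))]
      simp_rw [integral_mul_const, hw]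
    have hfu' : f u = (∫ x, p.eval x ∂μ) + (v - ∫ x, x ^ K ∂μ) * p.coeff K := by
      have hlast : p.coeff K = f (Pi.single (Fin.last K) 1) := coeff_dualPolynomial f (Fin.last K)
      have hsingle : (Pi.single (Fin.last K) (v - ∫ x, x ^ K ∂μ) : Fin (K + 1) → ℝ)
          = (v - ∫ x, x ^ K ∂μ) • Pi.single (Fin.last K) 1 := by
        rw [← Pi.single_smul, smul_eq_mul, mul_one]
      rw [hu, map_add, hfw, hsingle, map_smul, hlast, smul_eq_mul]
    have hcoeff := Polynomial.coeff_nonneg_of_nonneg hdeg hpos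
    rcases hcoeff.eq_or_lt with h | h
    · have hdeg' : p.natDegree ≤ K - 1 := by
        rw [Polynomial.natDegree_le_iff_coeff_eq_zero]
        intro N hN
        rcases (show K ≤ N by omega).eq_or_lt with rfl | hlt
        · exact h.symm
        · exact Polynomial.coeff_eq_zero_of_natDegree_lt (by omega)
      have := Polynomial.integral_eval_pos_of_nonneg (fun m hm => hint m (by omega)) hs
        (dualPolynomial_ne_zero hf0) hdeg' hpos
      rw [hfu', ← h, mul_zero, add_zero] at hfu
      linarith
    · have h1 : 0 ≤ ∫ x, p.eval x ∂μ := integral_nonneg hpos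
      have h2 := mul_pos (sub_pos.2 hv) h
      linarith
  obtain ⟨ν, hν, hi, hm⟩ := hmem
  have hlow : ∀ m < K, ∫ x, x ^ m ∂ν = ∫ x, x ^ m ∂μ := by
    intro m hmK
    have := hm ⟨m, by omega⟩
    rw [hu, Pi.add_apply, Pi.single_eq_of_ne (by simp [Fin.ext_iff]; omega)] at this
    simpa [hw] using this
  refine ⟨ν, ⟨?_⟩, hi, hlow, ?_⟩
  · have := hlow 0 (by omega)
    simp only [pow_zero, integral_const, smul_eq_mul, mul_one, probReal_univ] at this
    rw [Measure.real] at this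
    exact (ENNReal.toReal_eq_one_iff _).1 this
  · have := hm (Fin.last K)
    rw [hu, Pi.add_apply, Pi.single_eq_same] at this
    simpa [hw] using this

/-! ### Polynomial systems with finitely many solutions -/

open MvPolynomial in
/-- If `X_j ^ N` agrees on `Z` with a polynomial of smaller total degree for every variable `X_j`,
then the polynomial functions on `Z` form a finite-dimensional space, so `Z` is finite. -/
theorem MvPolynomial.finite_of_pow_eq_lower_degree {k σ : Type*} [Field k] [Fintype σ]
    {Z : Set (σ → k)} {N : ℕ}
    (h : ∀ j, ∃ r : MvPolynomial σ k, r.totalDegree < N ∧ ∀ x ∈ Z, x j ^ N = eval x r) :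
    Z.Finite := by
  classical
  choose r hr hZ using h
  let φ : MvPolynomial σ k →ₐ[k] (Z → k) := AlgHom.pi fun x => MvPolynomial.aeval x.1
  have hφ : ∀ p x, φ p x = eval x.1 p := fun p x => by simp [φ, MvPolynomial.aeval_eq_eval]
  set M := Fintype.card σ * N
  let V : Submodule k (Z → k) := (restrictTotalDegree σ k M).map φ.toLinearMap
  have hV : ∀ D, ∀ p : MvPolynomial σ k, p.totalDegree ≤ D → φ p ∈ V := by
    intro D
    induction D using Nat.strong_induction_on with
    | _ D ih =>
    intro p hp
    rw [p.as_sum, map_sum]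
    refine Submodule.sum_mem _ fun s hs => ?_
    have hsD : s.degree ≤ D := (le_totalDegree hs).trans hp
    by_cases hsM : s.degree ≤ M
    · refine Submodule.mem_map_of_mem ?_
      rw [mem_restrictTotalDegree]
      exact (totalDegree_monomial_le _ _).trans hsM
    · obtain ⟨j, hj⟩ : ∃ j, N ≤ s j := by
        by_contra! hlt
        refine hsM ?_
        rw [Finsupp.degree_eq_sum]
        calc ∑ i, s i ≤ ∑ _i : σ, N := Finset.sum_le_sum fun i _ => (hlt i).le
          _ = M := by simp [M]
      have hsplit : s = (s - Finsupp.single j N) + Finsupp.single j N :=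
        (tsub_add_cancel_of_le (by simpa using hj)).symm
      have hdeg : s.degree = (s - Finsupp.single j N).degree + N := by
        conv_lhs => rw [hsplit]
        simp
      have heq : φ (monomial s (p.coeff s))
          = φ (monomial (s - Finsupp.single j N) (p.coeff s) * r j) := by
        ext x
        rw [hφ, hφ, map_mul, ← hZ j x.1 x.2]
        have hmon : monomial s (p.coeff s)
            = monomial (s - Finsupp.single j N) (p.coeff s) * X j ^ N := by
          rw [← monomial_add_single, ← hsplit]
        rw [hmon, map_mul, map_pow, eval_X]
      rw [heq]
      have hlt : (monomial (s - Finsupp.single j N) (p.coeff s) * r j).totalDegree < s.degree := by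
        refine (totalDegree_mul _ _).trans_lt ?_
        have h1 := totalDegree_monomial_le (s - Finsupp.single j N) (p.coeff s)
        have h2 := hr j
        change _ ≤ (s - Finsupp.single j N).degree at h1
        omega
      exact ih _ (hlt.trans_le hsD) _ le_rfl
  have : FiniteDimensional k V := inferInstance
  have hpoly : ∀ j, ∃ q : Polynomial k, q ≠ 0 ∧ ∀ x ∈ Z, q.eval (x j) = 0 := by
    intro j
    let ψ : Polynomial k →ₗ[k] V :=
      LinearMap.codRestrict V (φ.toLinearMap ∘ₗ (Polynomial.aeval (X j)).toLinearMap)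
        fun q => hV _ _ le_rfl
    have hψ : ¬ Function.Injective ψ := fun hinj =>
      Polynomial.not_finite (R := k) (Module.Finite.of_injective ψ hinj)
    rw [injective_iff_map_eq_zero] at hψ
    push Not at hψ
    obtain ⟨q, hq, hq0⟩ := hψ
    refine ⟨q, hq0, fun x hx => ?_⟩
    have h1 : φ (Polynomial.aeval (X j) q) ⟨x, hx⟩ = 0 := congrFun (congrArg Subtype.val hq) ⟨x, hx⟩
    rw [hφ, ← MvPolynomial.coe_aeval_eq_eval, RingHom.coe_coe, ← Polynomial.aeval_algHom_apply] at h1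
    simpa [Polynomial.aeval_def, Polynomial.eval₂_eq_eval_map] using h1
  choose q hq0 hq using hpoly
  refine (Set.Finite.pi' (t := fun j => {y | (q j).IsRoot y}) fun j =>
    Polynomial.finite_setOfPred_isRoot (hq0 j)).subset fun x hx j => hq j x hx

open MvPolynomial in
attribute [local instance] MvPolynomial.gradedAlgebra in
theorem MvPolynomial.homogeneousComponent_mul_of_isHomogeneous {R σ : Type*} [CommSemiring R]
    (p : MvPolynomial σ R) {q : MvPolynomial σ R} {d : ℕ} (hq : q.IsHomogeneous d) (n : ℕ) :
    homogeneousComponent n (p * q)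
      = (if d ≤ n then homogeneousComponent (n - d) p else 0) * q := by
  have h := DirectSum.coe_decompose_mul_of_right_mem (homogeneousSubmodule σ R) n
    (a := p) ((mem_homogeneousSubmodule d q).2 hq)
  have hdec : ∀ (r : MvPolynomial σ R) (i : ℕ),
      (DirectSum.decompose (homogeneousSubmodule σ R) r i : MvPolynomial σ R)
        = homogeneousComponent i r := fun r i => decomposition.decompose'_apply r i
  rw [hdec, hdec] at h
  rw [h, ite_mul, zero_mul]

open MvPolynomial in
/-- A polynomial system whose leading forms have no common zero other than the origin has finitely
many solutions.  By the Nullstellensatz, a power of each variable lies in the ideal of the leading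
forms. -/
theorem MvPolynomial.finite_zeros_of_leadingForms {k σ ι : Type*} [Field k] [IsAlgClosed k]
    [Fintype σ] [Fintype ι] {f F : ι → MvPolynomial σ k} {d : ι → ℕ}
    (hF : ∀ i, (F i).IsHomogeneous (d i)) (hlow : ∀ i, (f i - F i).totalDegree < d i)
    (hz : ∀ x : σ → k, (∀ i, eval x (F i) = 0) → x = 0) :
    {x : σ → k | ∀ i, eval x (f i) = 0}.Finite := by
  classical
  set I : Ideal (MvPolynomial σ k) := Ideal.span (Set.range F) with hI
  have hrad : ∀ j, ∃ n : ℕ, (X j : MvPolynomial σ k) ^ n ∈ I := by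
    intro j
    have : (X j : MvPolynomial σ k) ∈ I.radical := by
      rw [← vanishingIdeal_zeroLocus_eq_radical (K := k), mem_vanishingIdeal_iff]
      intro x hx
      have : x = 0 := hz x fun i => by
        have := hx (F i) (Ideal.subset_span ⟨i, rfl⟩)
        simpa [MvPolynomial.aeval_eq_eval] using this
      simp [this]
    exact this
  choose n hn using hrad
  set N := ∑ j, n j with hN
  refine finite_of_pow_eq_lower_degree (N := N + 1) fun j => ?_
  have hmem : (X j : MvPolynomial σ k) ^ (N + 1) ∈ I :=
    I.pow_mem_of_pow_mem (hn j)
      ((Finset.single_le_sum (f := n) (fun _ _ => Nat.zero_le _) (Finset.mem_univ j)).trans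
        (Nat.le_succ _))
  obtain ⟨G, hG⟩ := (Ideal.mem_span_range_iff_exists_fun).1 hmem
  -- The homogeneous component of degree `N + 1` of the identity `∑ G i * F i = X j ^ (N + 1)`.
  let G' : ι → MvPolynomial σ k := fun i =>
    if d i ≤ N + 1 then homogeneousComponent (N + 1 - d i) (G i) else 0
  have hG' : ∑ i, G' i * F i = X j ^ (N + 1) := by
    have h1 : homogeneousComponent (N + 1) (X j ^ (N + 1) : MvPolynomial σ k) = X j ^ (N + 1) :=
      homogeneousComponent_eq_self (isHomogeneous_X_pow j (N + 1))
    rw [← h1, ← hG, map_sum]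
    refine Finset.sum_congr rfl fun i _ => ?_
    rw [homogeneousComponent_mul_of_isHomogeneous _ (hF i)]
  refine ⟨∑ i, G' i * (F i - f i), ?_, fun x hx => ?_⟩
  · refine (totalDegree_finsetSum_le (d := N) fun i _ => ?_).trans_lt (Nat.lt_succ_self N)
    by_cases hd : d i ≤ N + 1
    · simp only [G', if_pos hd]
      refine (totalDegree_mul _ _).trans ?_
      have h1 := (homogeneousComponent_isHomogeneous (N + 1 - d i) (G i)).totalDegree_le
      have h2 := hlow i
      rw [← totalDegree_neg, neg_sub] at h2
      omega
    · simp [G', if_neg hd]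
  · have h1 := congrArg (eval x) hG'
    rw [map_pow, eval_X] at h1
    rw [← h1, map_sum, map_sum]
    refine Finset.sum_congr rfl fun i _ => ?_
    rw [map_mul, map_mul, map_sub, hx i, sub_zero]

/-- Weighted power sums of orders `1, …, K` with weights `c` vanish at constant vectors only,
provided that no weights of a nonempty strict subset of the indices sum to zero: test the weights
against a polynomial that vanishes at all values of `x` but one. -/
theorem eq_of_weighted_power_sums_eq_zero {k : Type*} [Field k] {K : ℕ} {c x : Fin K → k}
    (hc : ∀ J : Finset (Fin K), J.Nonempty → J ≠ Finset.univ → ∑ i ∈ J, c i ≠ 0)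
    (h : ∀ m ∈ Finset.Icc 1 K, ∑ i, c i * x i ^ m = 0) (i j : Fin K) : x i = x j := by
  classical
  have key : ∀ i, x i ≠ 0 → ∀ j, x j = x i := by
    intro i hi
    set S := (Finset.univ.image x).erase (x i) with hS
    have hcard : S.card + 1 ≤ K := by
      rw [hS, Finset.card_erase_add_one (Finset.mem_image_of_mem _ (Finset.mem_univ i))]
      simpa using Finset.card_image_le (s := Finset.univ) (f := x)
    set p : Polynomial k := Polynomial.X * ∏ z ∈ S, (Polynomial.X - Polynomial.C z) with hp
    have hdeg : p.natDegree ≤ K := by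
      refine Polynomial.natDegree_mul_le.trans ?_
      rw [Polynomial.natDegree_prod_of_monic _ _ fun z _ => Polynomial.monic_X_sub_C z]
      simp only [Polynomial.natDegree_X, Polynomial.natDegree_X_sub_C, Finset.sum_const,
        smul_eq_mul, mul_one]
      omega
    have hsum : ∑ l, c l * p.eval (x l) = 0 := by
      simp_rw [Polynomial.eval_eq_sum_range' (Nat.lt_succ_of_le hdeg), Finset.mul_sum]
      rw [Finset.sum_comm]
      refine Finset.sum_eq_zero fun m hm => ?_
      rcases Nat.eq_zero_or_pos m with rfl | hm0
      · have : p.coeff 0 = 0 := by simp [hp]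
        simp [this]
      · have := h m (Finset.mem_Icc.2 ⟨hm0, by simpa [Nat.lt_succ_iff] using hm⟩)
        calc ∑ l, c l * (p.coeff m * x l ^ m) = p.coeff m * ∑ l, c l * x l ^ m := by
              rw [Finset.mul_sum]; exact Finset.sum_congr rfl fun l _ => by ring
          _ = 0 := by rw [this, mul_zero]
    have heval : ∀ l, x l ≠ x i → p.eval (x l) = 0 := by
      intro l hl
      have hmem : x l ∈ S := Finset.mem_erase.2 ⟨hl, Finset.mem_image_of_mem _ (Finset.mem_univ l)⟩
      rw [hp, Polynomial.eval_mul, Polynomial.eval_prod, Finset.prod_eq_zero hmem (by simp),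
        mul_zero]
    have hne : p.eval (x i) ≠ 0 := by
      rw [hp, Polynomial.eval_mul, Polynomial.eval_prod]
      refine mul_ne_zero (by simpa using hi) (Finset.prod_ne_zero_iff.2 fun z hz => ?_)
      simpa [sub_eq_zero] using (Finset.ne_of_mem_erase hz).symm
    set J := Finset.univ.filter fun l => x l = x i with hJ
    have hJsum : ∑ l ∈ J, c l = 0 := by
      have h1 : ∑ l, c l * p.eval (x l) = (∑ l ∈ J, c l) * p.eval (x i) := by
        rw [hJ, Finset.sum_filter, Finset.sum_mul]
        refine Finset.sum_congr rfl fun l _ => ?_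
        split_ifs with hl
        · rw [hl]
        · rw [heval l hl]; simp
      rw [h1] at hsum
      exact (mul_eq_zero.1 hsum).resolve_right hne
    have hJuniv : J = Finset.univ := by
      by_contra hne'
      exact hc J ⟨i, by simp [hJ]⟩ hne' hJsum
    intro j
    have : j ∈ J := hJuniv ▸ Finset.mem_univ j
    simpa [hJ] using this
  by_cases hi : x i = 0
  · by_cases hj : x j = 0
    · rw [hi, hj]
    · exact key j hj i
  · exact (key i hi j).symm

open MvPolynomial in
/-- The equations satisfied by the elements of `A(S_{K-1})`, for arbitrary coefficients `a j k` in
place of the differences of weighted moments of order `j`, have finitely many real solutions.  The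
leading forms are the power sums with weights `a 0 k`, together with the linear form with
coefficients `q`. -/
theorem finite_solutions_moment_equations {K : ℕ} {q : Fin K → ℝ} {a : ℕ → Fin K → ℝ}
    (hc : ∀ J : Finset (Fin K), J.Nonempty → J ≠ Finset.univ → ∑ k ∈ J, a 0 k ≠ 0)
    (hq : ∀ k, 0 < q k) :
    {δ : Fin K → ℝ | (∀ m ∈ Finset.Icc 1 K,
        ∑ k, ∑ j ∈ Finset.range (m + 1), a j k * δ k ^ (m - j) * m.choose j = 0) ∧
      ∑ k, q k * δ k = 0}.Finite := by
  let F : Option (Fin K) → MvPolynomial (Fin K) ℂ := fun o => o.elim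
    (∑ k, C (q k : ℂ) * X k) fun i => ∑ k, C (a 0 k : ℂ) * X k ^ (i.1 + 1)
  let f : Option (Fin K) → MvPolynomial (Fin K) ℂ := fun o => F o + o.elim 0 fun i =>
    ∑ k, ∑ j ∈ Finset.range (i.1 + 1),
      C (a (j + 1) k * (i.1 + 1).choose (j + 1) : ℂ) * X k ^ (i.1 + 1 - (j + 1))
  let d : Option (Fin K) → ℕ := fun o => o.elim 1 fun i => i.1 + 1
  have hfin : {x : Fin K → ℂ | ∀ o, eval x (f o) = 0}.Finite := by
    refine finite_zeros_of_leadingForms (F := F) (d := d) ?_ ?_ ?_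
    · rintro (_ | i)
      · exact IsHomogeneous.sum _ _ _ fun k _ => isHomogeneous_C_mul_X _ _
      · exact IsHomogeneous.sum _ _ _ fun k _ => isHomogeneous_C_mul_X_pow _ _ _
    · rintro (_ | i)
      · simp [f, d]
      · simp only [f, add_sub_cancel_left, d, Option.elim_some]
        refine (totalDegree_finsetSum_le (d := i.1) fun k _ =>
          totalDegree_finsetSum_le fun j _ => ?_).trans_lt (Nat.lt_succ_self _)
        exact (isHomogeneous_C_mul_X_pow _ _ _).totalDegree_le.trans (by omega)
    · intro x hx
      have hconst := eq_of_weighted_power_sums_eq_zero (c := fun k => (a 0 k : ℂ)) (x := x)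
        (fun J hJ hJ' => by exact_mod_cast hc J hJ hJ') (fun m hm => by
          obtain ⟨h1, h2⟩ := Finset.mem_Icc.1 hm
          have := hx (some ⟨m - 1, by omega⟩)
          simpa [F, Nat.sub_add_cancel h1] using this)
      funext k
      have h0 : ∑ l, (q l : ℂ) * x l = 0 := by simpa [F] using hx none
      have h1 : (∑ l, (q l : ℂ)) * x k = 0 := by
        rw [← h0, Finset.sum_mul]
        exact Finset.sum_congr rfl fun l _ => by rw [hconst k l]
      refine (mul_eq_zero.1 h1).resolve_left ?_
      have : (0 : ℝ) < ∑ l, q l := Finset.sum_pos (fun l _ => hq l) ⟨k, Finset.mem_univ k⟩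
      exact_mod_cast this.ne'
  have hinj : Function.Injective fun (δ : Fin K → ℝ) (k : Fin K) => (δ k : ℂ) :=
    fun δ δ' h => funext fun k => Complex.ofReal_injective (congrFun h k)
  refine (hfin.preimage hinj.injOn).subset ?_
  rintro δ ⟨h1, h2⟩ (_ | i)
  · have : ((∑ k, q k * δ k : ℝ) : ℂ) = 0 := by rw [h2]; simp
    simpa [f, F] using this
  · have := h1 (i.1 + 1) (Finset.mem_Icc.2 ⟨by omega, by omega⟩)
    simp_rw [Finset.sum_range_succ' _ (i.1 + 1), Finset.sum_add_distrib] at this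
    have h3 := congrArg (fun r : ℝ => (r : ℂ)) this
    simp only [f, F, Option.elim_some, map_add, map_sum, map_mul, map_pow, eval_C, eval_X]
    rw [add_comm]
    push_cast at h3
    simp only [Nat.choose_zero_right, Nat.cast_one, mul_one] at h3
    rw [← h3]
    congr 1
    exact Finset.sum_congr rfl fun k _ => Finset.sum_congr rfl fun j _ => by
      rw [Nat.add_sub_add_right]; ring

/-! ### Translates of the positive orthant in a subspace -/

section OrthantSlice

variable {ι : Type*} [Fintype ι] {H : Submodule ℝ (ι → ℝ)} {b : ι → ℝ}

/-- A subspace that contains the constant vectors meets every translate of the open positive orthant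
in sets that contain arbitrarily large balls. -/
theorem exists_ball_subset_orthant_slice (h1 : (1 : ι → ℝ) ∈ H) (b : ι → ℝ) (r : ℝ) :
    ∃ w : H, Metric.ball w r ⊆ {v : H | ∀ i, b i < (v : ι → ℝ) i} := by
  let w : H := ⟨(‖b‖ + r) • (1 : ι → ℝ), H.smul_mem _ h1⟩
  refine ⟨w, fun v (hv : v ∈ Metric.ball w r) i => ?_⟩
  rw [mem_ball_iff_norm, Submodule.coe_norm] at hv
  have h2 : ‖(v : ι → ℝ) i - (‖b‖ + r) * 1‖ < r :=
    (norm_le_pi_norm ((v - w : H) : ι → ℝ) i).trans_lt hv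
  rw [mul_one, Real.norm_eq_abs] at h2
  have h3 := norm_le_pi_norm b i
  rw [Real.norm_eq_abs] at h3
  have := (abs_lt.1 h2).1
  have := le_abs_self (b i)
  linarith

theorem measure_orthant_slice [Nonempty ι] (h1 : (1 : ι → ℝ) ∈ H) (b : ι → ℝ) (μ : Measure H)
    [μ.IsAddHaarMeasure] : μ {v : H | ∀ i, b i < (v : ι → ℝ) i} = ⊤ := by
  have : Nontrivial H := ⟨⟨0, ⟨1, h1⟩, fun h => by
    have := congrFun (congrArg Subtype.val h) (Classical.arbitrary ι)
    simp at this⟩⟩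
  have : NoncompactSpace H := NormedSpace.noncompactSpace ℝ H
  have hball : ∀ n : ℕ, μ (Metric.ball 0 n) ≤ μ {v : H | ∀ i, b i < (v : ι → ℝ) i} := by
    intro n
    obtain ⟨w, hw⟩ := exists_ball_subset_orthant_slice h1 b n
    rw [← Measure.addHaar_ball_center μ w]
    exact measure_mono hw
  rw [eq_top_iff, ← measure_univ_of_isAddLeftInvariant μ, ← Metric.iUnion_ball_nat (0 : H),
    Monotone.measure_iUnion fun m n hmn => Metric.ball_subset_ball (by exact_mod_cast hmn)]
  exact iSup_le hball

theorem le_vectorSpan_of_orthant_slice_subset (h1 : (1 : ι → ℝ) ∈ H) {T : Set (ι → ℝ)}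
    (hT : ∀ v ∈ H, (∀ i, b i < v i) → v ∈ T) : H ≤ vectorSpan ℝ T := by
  intro u hu
  obtain ⟨w, hw⟩ := exists_ball_subset_orthant_slice h1 b (‖u‖ + 1)
  have hw0 : (w : ι → ℝ) ∈ T := hT _ w.2 (hw (Metric.mem_ball_self (by positivity)))
  have hwu : (w : ι → ℝ) + u ∈ T := by
    have hmem : w + ⟨u, hu⟩ ∈ Metric.ball w (‖u‖ + 1) := by
      rw [mem_ball_iff_norm, add_sub_cancel_left]
      exact lt_add_one ‖u‖
    exact hT _ (H.add_mem w.2 hu) (hw hmem)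
  simpa using vsub_mem_vectorSpan ℝ hwu hw0

theorem interior_nonempty_of_orthant_slice_subset (h1 : (1 : ι → ℝ) ∈ H) {T : Set (ι → ℝ)}
    (hT : ∀ v ∈ H, (∀ i, b i < v i) → v ∈ T) :
    (interior ((↑) ⁻¹' T : Set H)).Nonempty := by
  obtain ⟨w, hw⟩ := exists_ball_subset_orthant_slice h1 b 1
  exact ⟨w, interior_maximal (fun (v : H) hv => hT v v.2 (hw hv)) Metric.isOpen_ball
    (Metric.mem_ball_self one_pos)⟩

/-- An affine subspace of smaller dimension than `H` is a null set in `H`. -/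
theorem measure_preimage_affineSubspace_eq_zero (μ : Measure H) [μ.IsAddHaarMeasure]
    {E : AffineSubspace ℝ (ι → ℝ)}
    (hE : Module.finrank ℝ E.direction < Module.finrank ℝ H) :
    μ ((↑) ⁻¹' (E : Set (ι → ℝ))) = 0 := by
  have hne : E.comap H.subtype.toAffineMap ≠ ⊤ := by
    intro htop
    have hmem : ∀ v ∈ H, v ∈ E := fun v hv => by
      have : (⟨v, hv⟩ : H) ∈ E.comap H.subtype.toAffineMap := htop ▸ AffineSubspace.mem_top _ _ _
      simpa using this
    have hle : H ≤ E.direction := fun v hv => by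
      simpa using E.vsub_mem_direction (hmem v hv) (hmem 0 H.zero_mem)
    exact absurd (Submodule.finrank_mono hle) (not_le.2 hE)
  exact Measure.addHaar_affineSubspace μ _ hne

end OrthantSlice

/-! ### Conditional moments and admissible vectors -/

namespace BinaryIV

section Moments

variable {Ω : Type*} [MeasurableSpace Ω] {P : Measure Ω} {K : ℕ}
  {X : Ω → Fin K} {W : Ω → Fin 2} {U : Ω → ℝ}

/-- The support condition on the conditional laws forces the conditioning events to have positive
probability, since `condLaw` is the zero measure otherwise. -/
theorem measure_ne_zero_of_condLaw_support_nonempty {ℓ : Fin 2} {k : Fin K}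
    (h : (condLaw P X W U ℓ k).support.Nonempty) : P {ω | W ω = ℓ ∧ X ω = k} ≠ 0 := by
  intro h0
  rw [condLaw, cond_eq_zero_of_meas_eq_zero h0, Measure.map_zero, Measure.support_zero] at h
  exact Set.not_nonempty_empty h

theorem measure_W_ne_zero {ℓ : Fin 2} {k : Fin K} (h : P {ω | W ω = ℓ ∧ X ω = k} ≠ 0) :
    P {ω | W ω = ℓ} ≠ 0 :=
  fun h0 => h (measure_mono_null (fun _ hω => hω.1) h0)

theorem condProb_pos [IsFiniteMeasure P] (hW : Measurable W) {ℓ : Fin 2} {k : Fin K}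
    (h : P {ω | W ω = ℓ ∧ X ω = k} ≠ 0) : 0 < condProb P X W ℓ k := by
  have : IsProbabilityMeasure (P[|{ω | W ω = ℓ}]) :=
    cond_isProbabilityMeasure (measure_W_ne_zero h)
  exact ENNReal.toReal_pos (cond_pos_of_inter_ne_zero (hW (measurableSet_singleton ℓ)) h).ne'
    (measure_ne_top _ _)

theorem sum_condProb_eq (hX : Measurable X) (ℓ : Fin 2) (J : Finset (Fin K)) :
    ∑ k ∈ J, condProb P X W ℓ k = (P[|{ω | W ω = ℓ}]).real {ω | X ω ∈ (J : Set (Fin K))} :=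
  sum_measureReal_preimage_singleton J fun k _ => hX (measurableSet_singleton k)

theorem sum_condProb_univ [IsFiniteMeasure P] (hX : Measurable X) {ℓ : Fin 2}
    (h : P {ω | W ω = ℓ} ≠ 0) :
    ∑ k, condProb P X W ℓ k = 1 := by
  have : IsProbabilityMeasure (P[|{ω | W ω = ℓ}]) := cond_isProbabilityMeasure h
  rw [sum_condProb_eq hX]
  simp

theorem integrable_cond {s : Set Ω} {f : Ω → ℝ} (hf : Integrable f P) :
    Integrable f (P[|s]) := by
  by_cases h : P s = 0
  · rw [cond_eq_zero_of_meas_eq_zero h]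
    exact integrable_zero_measure
  · exact hf.restrict.smul_measure (ENNReal.inv_ne_top.2 h)

theorem integrable_pow_of_abs (hU : Measurable U) {m : ℕ}
    (h : Integrable (fun ω => |U ω| ^ m) P) : Integrable (fun ω => U ω ^ m) P := by
  refine h.mono' (hU.pow_const m).aestronglyMeasurable (Filter.Eventually.of_forall fun ω => ?_)
  rw [Real.norm_eq_abs, abs_pow]

theorem integral_condLaw_pow (hU : Measurable U) (ℓ : Fin 2) (k : Fin K) (m : ℕ) :
    ∫ x, x ^ m ∂(condLaw P X W U ℓ k) = condExpWX P X W (fun ω => U ω ^ m) ℓ k :=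
  integral_map hU.aemeasurable (measurable_id.pow_const m).aestronglyMeasurable

theorem integral_add_const_pow {ν : Measure ℝ} {n : ℕ}
    (h : ∀ m ≤ n, Integrable (fun x : ℝ => x ^ m) ν) (t : ℝ) :
    ∫ x, (x + t) ^ n ∂ν
      = ∑ j ∈ Finset.range (n + 1), (∫ x, x ^ j ∂ν) * t ^ (n - j) * n.choose j := by
  simp_rw [add_pow]
  rw [integral_finsetSum _ fun j hj => ((h j (Nat.lt_succ_iff.1 (Finset.mem_range.1 hj))).mul_const
    _).mul_const _]
  simp_rw [integral_mul_const]

/-- On `X = k` one has `Y - h_k = U + δ_k`, with `δ = g - h`. -/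
theorem condExpWX_pow_eq_sum (hX : Measurable X) (hW : Measurable W) (hU : Measurable U) {n : ℕ}
    (hint : ∀ m ≤ n, Integrable (fun ω => |U ω| ^ m) P) (g h : Fin K → ℝ) (ℓ : Fin 2)
    (k : Fin K) :
    condExpWX P X W (fun ω => (g (X ω) + U ω - h k) ^ n) ℓ k
      = ∑ j ∈ Finset.range (n + 1),
        condExpWX P X W (fun ω => U ω ^ j) ℓ k * (g k - h k) ^ (n - j) * n.choose j := by
  have hmeas : MeasurableSet {ω | W ω = ℓ ∧ X ω = k} :=
    (hW (measurableSet_singleton ℓ)).inter (hX (measurableSet_singleton k))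
  have h1 : condExpWX P X W (fun ω => (g (X ω) + U ω - h k) ^ n) ℓ k
      = ∫ x, (x + (g k - h k)) ^ n ∂(condLaw P X W U ℓ k) := by
    rw [condLaw, integral_map hU.aemeasurable
      (f := fun x => (x + (g k - h k)) ^ n)
      ((measurable_id.add_const _).pow_const n).aestronglyMeasurable]
    refine integral_congr_ae ?_
    filter_upwards [ae_cond_mem hmeas] with ω hω
    rw [hω.2]
    ring
  rw [h1, integral_add_const_pow]
  · simp_rw [integral_condLaw_pow hU]
  · intro m hm
    exact (integrable_map_measure (measurable_id.pow_const m).aestronglyMeasurable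
      hU.aemeasurable).2 (integrable_cond (integrable_pow_of_abs hU (hint m hm)))

theorem integral_comp_eq_sum [IsFiniteMeasure P] (hX : Measurable X) (δ : Fin K → ℝ) :
    ∫ ω, δ (X ω) ∂P = ∑ k, P.real {ω | X ω = k} * δ k := by
  rw [← integral_map (f := δ) hX.aemeasurable
      (measurable_of_finite δ).aestronglyMeasurable, integral_fintype Integrable.of_finite]
  refine Finset.sum_congr rfl fun k _ => ?_
  rw [map_measureReal_apply hX (measurableSet_singleton k), smul_eq_mul]
  rfl

/-- The constant direction lies in the hyperplane: raising all conditional `K`-th moments by the same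
amount keeps the `K`-th moment given `W` independent of `W`. -/
theorem one_mem_hyperplane [IsFiniteMeasure P] (hX : Measurable X) (h : ∀ ℓ, P {ω | W ω = ℓ} ≠ 0) :
    1 ∈ hyperplane P X W := by
  change ∑ k, condProb P X W 0 k * 1 = ∑ k, condProb P X W 1 k * 1
  simp_rw [mul_one, sum_condProb_univ hX (h _)]

/-- Every vector of the hyperplane that exceeds the true conditional `K`-th moments is
admissible. -/
theorem mem_admissible_of_lt [IsFiniteMeasure P] (hU : Measurable U) (hK : 1 ≤ K)
    (hint : ∀ m ≤ K, Integrable (fun ω => |U ω| ^ m) P)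
    (hsupp : ∀ (ℓ : Fin 2) (k : Fin K),
      (((K - 1) / 2 + 1 : ℕ) : ℕ∞) ≤ (condLaw P X W U ℓ k).support.encard)
    (hpos : ∀ ℓ k, P {ω | W ω = ℓ ∧ X ω = k} ≠ 0)
    {v : Fin 2 × Fin K → ℝ} (hv : v ∈ hyperplane P X W)
    (hlt : ∀ i : Fin 2 × Fin K, condExpWX P X W (fun ω => U ω ^ K) i.1 i.2 < v i) :
    v ∈ admissible P X W U := by
  have hex : ∀ ℓ k, ∃ ν : Measure ℝ, IsProbabilityMeasure ν ∧
      (∀ m : ℕ, Integrable (fun x : ℝ => x ^ m) ν) ∧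
      (∀ m < K, ∫ x, x ^ m ∂ν = condExpWX P X W (fun ω => U ω ^ m) ℓ k) ∧
      ∫ x, x ^ K ∂ν = v (ℓ, k) := by
    intro ℓ k
    have : IsProbabilityMeasure (P[|{ω | W ω = ℓ ∧ X ω = k}]) :=
      cond_isProbabilityMeasure (hpos ℓ k)
    have : IsProbabilityMeasure (condLaw P X W U ℓ k) :=
      Measure.isProbabilityMeasure_map hU.aemeasurable
    simp_rw [← integral_condLaw_pow hU]
    refine exists_measure_moments_of_integral_lt hK (fun m hm => ?_) (hsupp ℓ k) ?_
    · exact (integrable_map_measure (measurable_id.pow_const m).aestronglyMeasurable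
        hU.aemeasurable).2 (integrable_cond (integrable_pow_of_abs hU (hint m hm)))
    · rw [integral_condLaw_pow hU]
      exact hlt (ℓ, k)
  choose ν hν hi hlow htop using hex
  refine ⟨hv, ν, hν, fun ℓ k m _ => hi ℓ k m, fun ℓ k m hm => hlow ℓ k m ?_, htop⟩
  have := Finset.mem_Icc.1 hm
  omega

/-- The values of the `K`-th moment of a single law with prescribed lower moments form a convex
set. -/
theorem convex_setOf_top_moment (K : ℕ) (M : ℕ → ℝ) :
    Convex ℝ {r : ℝ | ∃ ν : Measure ℝ, IsProbabilityMeasure ν ∧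
      (∀ m ≤ K, Integrable (fun x : ℝ => x ^ m) ν) ∧
      (∀ m ∈ Finset.Icc 1 (K - 1), ∫ x, x ^ m ∂ν = M m) ∧ ∫ x, x ^ K ∂ν = r} := by
  rintro r ⟨ν, hν, hi, hlow, htop⟩ r' ⟨ν', hν', hi', hlow', htop'⟩ a b ha hb hab
  have hint : ∀ m ≤ K, Integrable (fun x : ℝ => x ^ m)
      (ENNReal.ofReal a • ν) ∧ Integrable (fun x : ℝ => x ^ m) (ENNReal.ofReal b • ν') :=
    fun m hm => ⟨(hi m hm).smul_measure ENNReal.ofReal_ne_top,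
      (hi' m hm).smul_measure ENNReal.ofReal_ne_top⟩
  have hmom : ∀ m ≤ K, ∫ x, x ^ m ∂(ENNReal.ofReal a • ν + ENNReal.ofReal b • ν')
      = a * ∫ x, x ^ m ∂ν + b * ∫ x, x ^ m ∂ν' := by
    intro m hm
    rw [integral_add_measure (hint m hm).1 (hint m hm).2, integral_smul_measure,
      integral_smul_measure, ENNReal.toReal_ofReal ha, ENNReal.toReal_ofReal hb, smul_eq_mul,
      smul_eq_mul]
  refine ⟨ENNReal.ofReal a • ν + ENNReal.ofReal b • ν', ⟨?_⟩,
    fun m hm => (hint m hm).1.add_measure (hint m hm).2, fun m hm => ?_, ?_⟩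
  · simp [← ENNReal.ofReal_add ha hb, hab]
  · rw [hmom m (by have := Finset.mem_Icc.1 hm; omega), hlow m hm, hlow' m hm, ← add_mul, hab,
      one_mul]
  · rw [hmom K le_rfl, htop, htop', smul_eq_mul, smul_eq_mul]

/-- `T` is cut out of the hyperplane by conditions on single coordinates, each of which is membership
in a convex subset of `ℝ`, that is, in an interval. -/
theorem measurableSet_preimage_admissible :
    MeasurableSet ((↑) ⁻¹' admissible P X W U : Set (hyperplane P X W)) := by
  set I : Fin 2 → Fin K → Set ℝ := fun ℓ k => {r : ℝ | ∃ ν : Measure ℝ, IsProbabilityMeasure ν ∧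
      (∀ m ≤ K, Integrable (fun x : ℝ => x ^ m) ν) ∧
      (∀ m ∈ Finset.Icc 1 (K - 1), ∫ x, x ^ m ∂ν = condExpWX P X W (fun ω => U ω ^ m) ℓ k) ∧
      ∫ x, x ^ K ∂ν = r} with hI
  have hset : ((↑) ⁻¹' admissible P X W U : Set (hyperplane P X W))
      = ⋂ ℓ, ⋂ k, {v : hyperplane P X W | (v : Fin 2 × Fin K → ℝ) (ℓ, k) ∈ I ℓ k} := by
    ext v
    simp only [Set.mem_preimage, Set.mem_iInter, Set.mem_ofPred_eq]
    constructor
    · rintro ⟨-, ν, h⟩ ℓ k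
      exact ⟨ν ℓ k, h.isProbabilityMeasure ℓ k, h.integrable ℓ k, h.lower_moments ℓ k,
        h.top_moment ℓ k⟩
    · intro h
      choose ν h1 h2 h3 h4 using h
      exact ⟨v.2, ν, h1, h2, h3, h4⟩
  rw [hset]
  refine MeasurableSet.iInter fun ℓ => MeasurableSet.iInter fun k => ?_
  have hIm : MeasurableSet (I ℓ k) :=
    (convex_setOf_top_moment K fun m =>
      condExpWX P X W (fun ω => U ω ^ m) ℓ k).ordConnected.measurableSet
  exact ((measurable_pi_apply (ℓ, k)).comp measurable_subtype_coe) hIm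

/-- The relevance of the instrument makes `A(S_{K-1})` finite. -/
theorem finite_solutionSet [IsFiniteMeasure P] (hX : Measurable X) (hW : Measurable W)
    (hU : Measurable U) (hrel : Relevant P X W)
    (hint : ∀ m ≤ K, Integrable (fun ω => |U ω| ^ m) P)
    (hpos : ∀ ℓ k, P {ω | W ω = ℓ ∧ X ω = k} ≠ 0) (g : Fin K → ℝ) :
    (solutionSet P X W U g).Finite := by
  have hone : ∀ ℓ k, condExpWX P X W (fun ω => U ω ^ 0) ℓ k = 1 := by
    intro ℓ k
    have : IsProbabilityMeasure (P[|{ω | W ω = ℓ ∧ X ω = k}]) :=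
      cond_isProbabilityMeasure (hpos ℓ k)
    simp [condExpWX]
  refine (finite_solutions_moment_equations (q := fun k => P.real {ω | X ω = k})
    (a := fun j k => condProb P X W 0 k * condExpWX P X W (fun ω => U ω ^ j) 0 k
      - condProb P X W 1 k * condExpWX P X W (fun ω => U ω ^ j) 1 k) ?_ ?_).subset ?_
  · intro J hJ hJ'
    simp_rw [hone, mul_one, Finset.sum_sub_distrib, sum_condProb_eq hX]
    exact sub_ne_zero.2 (hrel J (by simpa using hJ) (by simpa using hJ'))
  · intro k
    exact ENNReal.toReal_pos (fun h0 => hpos 0 k (measure_mono_null (fun _ hω => hω.2) h0))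
      (measure_ne_top _ _)
  · rintro δ ⟨h, rfl, hmom, hmean⟩
    refine ⟨fun m hm => ?_, ?_⟩
    · rw [← hmom m hm]
      refine Finset.sum_congr rfl fun k _ => ?_
      have hm' : ∀ j ≤ m, Integrable (fun ω => |U ω| ^ j) P :=
        fun j hj => hint j (hj.trans (Finset.mem_Icc.1 hm).2)
      rw [condExpWX_pow_eq_sum hX hW hU hm', condExpWX_pow_eq_sum hX hW hU hm', Finset.mul_sum,
        Finset.mul_sum, ← Finset.sum_sub_distrib]
      refine Finset.sum_congr rfl fun j _ => ?_
      rw [Pi.sub_apply]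
      ring
    · rw [← integral_comp_eq_sum hX]
      exact hmean

/-! ### The affine equation for the `K`-th moments -/

/-- The linear functional `v ↦ ∑ k, δ_k (p_k(0) v_{0,k} - p_k(1) v_{1,k})`, through which the `K`-th
moments `v` enter the difference between `W = 0` and `W = 1` of the moments of order `K + 1` of
`U + δ(X)`. -/
noncomputable def topMomentFunctional (p : Fin 2 → Fin K → ℝ) (δ : Fin K → ℝ) :
    (Fin 2 × Fin K → ℝ) →ₗ[ℝ] ℝ :=
  ∑ k, δ k • (p 0 k • LinearMap.proj (0, k) - p 1 k • LinearMap.proj (1, k))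

theorem topMomentFunctional_apply (p : Fin 2 → Fin K → ℝ) (δ : Fin K → ℝ)
    (v : Fin 2 × Fin K → ℝ) :
    topMomentFunctional p δ v = ∑ k, δ k * (p 0 k * v (0, k) - p 1 k * v (1, k)) := by
  simp [topMomentFunctional]

/-- For nonconstant `δ`, the functional `topMomentFunctional` is not a multiple of the one that
defines the hyperplane. -/
theorem hyperplane_inf_ker_lt (hp : ∀ k, condProb P X W 0 k ≠ 0) {δ : Fin K → ℝ} {i j : Fin K}
    (hij : δ i ≠ δ j) :
    hyperplane P X W ⊓ (topMomentFunctional (condProb P X W) δ).ker < hyperplane P X W := by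
  refine lt_of_le_of_ne inf_le_left fun h => ?_
  set p := condProb P X W
  -- A vector of the hyperplane, supported on `W = 0`, at which the functional is `δ i - δ j`.
  let v : Fin 2 × Fin K → ℝ := fun x =>
    if x.1 = 0 then (if x.2 = i then (p 0 i)⁻¹ else 0) - (if x.2 = j then (p 0 j)⁻¹ else 0) else 0
  have hv : v ∈ hyperplane P X W := by
    change ∑ k, p 0 k * v (0, k) = ∑ k, p 1 k * v (1, k)
    simp [v, mul_sub, Finset.sum_sub_distrib, hp]
  have hker := (inf_eq_left.1 h) hv
  rw [LinearMap.mem_ker, topMomentFunctional_apply] at hker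
  simp only [v, if_true, mul_sub, Finset.sum_sub_distrib, mul_ite, mul_zero, Finset.sum_ite_eq',
    Finset.mem_univ, one_ne_zero, if_false, sub_zero] at hker
  rw [mul_inv_cancel₀ (hp i), mul_inv_cancel₀ (hp j)] at hker
  apply hij
  linarith

/-- Expanding the moment of order `K + 1` of `x + δ_k`, the terms of order `K + 1` cancel and those
of order `K` give `(K + 1) * topMomentFunctional`; the remaining terms depend on the lower moments
only. -/
theorem topMomentFunctional_eq_of_moment_eq [IsFiniteMeasure P]
    (hpos : ∀ ℓ k, P {ω | W ω = ℓ ∧ X ω = k} ≠ 0)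
    {v : Fin 2 × Fin K → ℝ} {ν : Fin 2 → Fin K → Measure ℝ} (hν : Extends P X W U v ν)
    (hint : ∀ ℓ k, Integrable (fun x : ℝ => x ^ (K + 1)) (ν ℓ k))
    (htop : ∑ k, condProb P X W 0 k * ∫ x, x ^ (K + 1) ∂(ν 0 k)
        = ∑ k, condProb P X W 1 k * ∫ x, x ^ (K + 1) ∂(ν 1 k))
    {δ : Fin K → ℝ}
    (hδ : ∑ k, (condProb P X W 0 k * ∫ x, (x + δ k) ^ (K + 1) ∂(ν 0 k)
          - condProb P X W 1 k * ∫ x, (x + δ k) ^ (K + 1) ∂(ν 1 k)) = 0) :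
    topMomentFunctional (condProb P X W) δ v
      = -(∑ k, (condProb P X W 0 k * ∑ j ∈ Finset.range K,
            condExpWX P X W (fun ω => U ω ^ j) 0 k * δ k ^ (K + 1 - j) * (K + 1).choose j
          - condProb P X W 1 k * ∑ j ∈ Finset.range K,
            condExpWX P X W (fun ω => U ω ^ j) 1 k * δ k ^ (K + 1 - j) * (K + 1).choose j))
        / (K + 1) := by
  have hexp : ∀ ℓ k, ∫ x, (x + δ k) ^ (K + 1) ∂(ν ℓ k)
      = ∑ j ∈ Finset.range K,
          condExpWX P X W (fun ω => U ω ^ j) ℓ k * δ k ^ (K + 1 - j) * (K + 1).choose j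
        + v (ℓ, k) * δ k * (K + 1) + ∫ x, x ^ (K + 1) ∂(ν ℓ k) := by
    intro ℓ k
    rw [integral_add_const_pow, Finset.sum_range_succ, Finset.sum_range_succ, hν.top_moment]
    · congr 1
      · congr 1
        · refine Finset.sum_congr rfl fun j hj => ?_
          have hjK := Finset.mem_range.1 hj
          rcases Nat.eq_zero_or_pos j with rfl | hj0
          · have := hν.isProbabilityMeasure ℓ k
            have : IsProbabilityMeasure (P[|{ω | W ω = ℓ ∧ X ω = k}]) :=
              cond_isProbabilityMeasure (hpos ℓ k)
            simp [condExpWX]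
          · rw [hν.lower_moments ℓ k j (Finset.mem_Icc.2 ⟨hj0, by omega⟩)]
        · simp
      · simp
    · intro m hm
      rcases hm.lt_or_eq with h | rfl
      · exact hν.integrable ℓ k m (Nat.lt_succ_iff.1 h)
      · exact hint ℓ k
  have hK : (K + 1 : ℝ) ≠ 0 := by positivity
  rw [eq_div_iff hK, topMomentFunctional_apply, Finset.sum_mul, eq_neg_iff_add_eq_zero,
    ← Finset.sum_add_distrib]
  simp_rw [hexp] at hδ
  have h2 := sub_eq_zero.2 htop
  rw [← Finset.sum_sub_distrib] at h2
  rw [← sub_eq_zero.2 (hδ.trans h2.symm), ← Finset.sum_sub_distrib]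
  exact Finset.sum_congr rfl fun k _ => by ring

end Moments

end BinaryIV

theorem proposition3p5 {Ω : Type*} [MeasurableSpace Ω] (P : Measure Ω) [IsProbabilityMeasure P]
    {K : ℕ} (X : Ω → Fin K) (W : Ω → Fin 2) (U : Ω → ℝ) (g : Fin K → ℝ)
    (hX : Measurable X) (hW : Measurable W) (hU : Measurable U)
    (hrel : BinaryIV.Relevant P X W)
    (hint : ∀ m ≤ K + 1, Integrable (fun ω => |U ω| ^ m) P)
    (hmean : ∫ ω, U ω ∂P = 0)
    (hindep : ∀ m ∈ Finset.Icc 1 (K + 1), ∀ ℓ : Fin 2,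
      BinaryIV.condExpW P W (fun ω => U ω ^ m) ℓ = ∫ ω, U ω ^ m ∂P)
    (hsupp : ∀ (ℓ : Fin 2) (k : Fin K),
      (((K - 1) / 2 + 1 : ℕ) : ℕ∞) ≤ (BinaryIV.condLaw P X W U ℓ k).support.encard) :
    (∃ F : Set (AffineSubspace ℝ (Fin 2 × Fin K → ℝ)), F.Finite ∧
      (∀ E ∈ F, Module.finrank ℝ E.direction
        < Module.finrank ℝ (vectorSpan ℝ (BinaryIV.admissible P X W U))) ∧
      BinaryIV.nonIdentified P X W U g ⊆ ⋃ E ∈ F, (E : Set (Fin 2 × Fin K → ℝ))) ∧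
    (interior ((↑) ⁻¹' BinaryIV.admissible P X W U : Set (BinaryIV.hyperplane P X W))).Nonempty ∧
    MeasurableSet ((↑) ⁻¹' BinaryIV.admissible P X W U : Set (BinaryIV.hyperplane P X W)) ∧
    ∀ (μ : Measure (BinaryIV.hyperplane P X W)) [μ.IsAddHaarMeasure],
      μ ((↑) ⁻¹' BinaryIV.admissible P X W U) = ⊤ ∧
      μ ((↑) ⁻¹' BinaryIV.nonIdentified P X W U g) = 0 := by
  open BinaryIV in
  -- As `P` is a probability measure, `Ω` is nonempty, so the range `Fin K` of `X` is as well.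
  obtain ⟨ω₀⟩ : Nonempty Ω := nonempty_of_isProbabilityMeasure P
  have k₀ : Fin K := X ω₀
  have hK : 1 ≤ K := k₀.pos
  have : Nonempty (Fin 2 × Fin K) := ⟨(0, k₀)⟩
  have hintK : ∀ m ≤ K, Integrable (fun ω => |U ω| ^ m) P := fun m hm => hint m (by omega)
  have hpos : ∀ ℓ k, P {ω | W ω = ℓ ∧ X ω = k} ≠ 0 := fun ℓ k =>
    measure_ne_zero_of_condLaw_support_nonempty (Set.encard_pos.1 (lt_of_lt_of_le
      (by exact_mod_cast Nat.succ_pos _) (hsupp ℓ k)))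
  have h1 : 1 ∈ hyperplane P X W :=
    one_mem_hyperplane hX fun ℓ => measure_W_ne_zero (hpos ℓ k₀)
  have hT : ∀ v ∈ hyperplane P X W,
      (∀ i : Fin 2 × Fin K, condExpWX P X W (fun ω => U ω ^ K) i.1 i.2 < v i) →
      v ∈ admissible P X W U :=
    fun v hv hlt => mem_admissible_of_lt hU hK hintK hsupp hpos hv hlt
  have hspan : hyperplane P X W ≤ vectorSpan ℝ (admissible P X W U) :=
    le_vectorSpan_of_orthant_slice_subset h1 hT
  -- The affine subspaces are indexed by the nonzero `δ` in the finite set `A(S_{K-1})`. The base point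
  -- given by `epsilon` is arbitrary where the equation has no solution, which does no harm.
  let φ := topMomentFunctional (condProb P X W)
  let c : (Fin K → ℝ) → ℝ := fun δ =>
    -(∑ k, (condProb P X W 0 k * ∑ j ∈ Finset.range K,
          condExpWX P X W (fun ω => U ω ^ j) 0 k * δ k ^ (K + 1 - j) * (K + 1).choose j
        - condProb P X W 1 k * ∑ j ∈ Finset.range K,
          condExpWX P X W (fun ω => U ω ^ j) 1 k * δ k ^ (K + 1 - j) * (K + 1).choose j))
      / (K + 1)
  let E : (Fin K → ℝ) → AffineSubspace ℝ (Fin 2 × Fin K → ℝ) := fun δ =>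
    AffineSubspace.mk' (Classical.epsilon fun v => v ∈ hyperplane P X W ∧ φ δ v = c δ)
      (hyperplane P X W ⊓ (φ δ).ker)
  let D : Set (Fin K → ℝ) := {δ ∈ solutionSet P X W U g | δ ≠ 0}
  have hE : ∀ δ ∈ D, Module.finrank ℝ (E δ).direction < Module.finrank ℝ (hyperplane P X W) := by
    rintro δ ⟨⟨h, rfl, -, hmean0⟩, hδ0⟩
    obtain ⟨i, j, hij⟩ : ∃ i j, (g - h) i ≠ (g - h) j := by
      -- A constant `δ` with `E[δ(X)] = 0` vanishes.
      by_contra! hconst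
      refine hδ0 (funext fun k => ?_)
      have : ∀ ω, g (X ω) - h (X ω) = (g - h) k := fun ω => hconst (X ω) k
      simpa [this] using hmean0
    rw [AffineSubspace.direction_mk']
    exact Submodule.finrank_lt_finrank_of_lt
      (hyperplane_inf_ker_lt (fun k => (condProb_pos hW (hpos 0 k)).ne') hij)
  have hsub : nonIdentified P X W U g ⊆ ⋃ S ∈ E '' D, (S : Set (Fin 2 × Fin K → ℝ)) := by
    rintro v ⟨⟨hvH, -⟩, ν, hν, hνint, hνtop, δ, hδA, hδ0, hδ, -⟩
    have hv : v ∈ hyperplane P X W ∧ φ δ v = c δ :=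
      ⟨hvH, topMomentFunctional_eq_of_moment_eq hpos hν hνint
        (hνtop _ (Finset.mem_Icc.2 ⟨by omega, le_rfl⟩)) (hδ _ (Finset.mem_Icc.2 ⟨by omega, le_rfl⟩))⟩
    have hε := Classical.epsilon_spec (p := fun v => v ∈ hyperplane P X W ∧ φ δ v = c δ) ⟨v, hv⟩
    refine Set.mem_biUnion (Set.mem_image_of_mem E ⟨hδA, hδ0⟩) ?_
    change v ∈ AffineSubspace.mk' _ _
    rw [AffineSubspace.mem_mk', vsub_eq_sub]
    refine ⟨Submodule.sub_mem _ hv.1 hε.1, ?_⟩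
    rw [SetLike.mem_coe, LinearMap.mem_ker, map_sub, hv.2, hε.2, sub_self]
  have hfin : (E '' D).Finite :=
    ((finite_solutionSet hX hW hU hrel hintK hpos g).subset fun δ hδ => hδ.1).image E
  refine ⟨⟨E '' D, hfin, ?_, hsub⟩, interior_nonempty_of_orthant_slice_subset h1 hT,
    measurableSet_preimage_admissible, fun μ _ => ⟨?_, ?_⟩⟩
  · rintro _ ⟨δ, hδ, rfl⟩
    exact (hE δ hδ).trans_le (Submodule.finrank_mono hspan)
  · rw [eq_top_iff, ← measure_orthant_slice h1
      (fun i : Fin 2 × Fin K => condExpWX P X W (fun ω => U ω ^ K) i.1 i.2) μ]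
    exact measure_mono fun v hv => hT v v.2 hv
  · refine measure_mono_null (Set.preimage_mono hsub) ?_
    rw [Set.preimage_iUnion₂, measure_biUnion_null_iff hfin.countable]
    rintro _ ⟨δ, hδ, rfl⟩
    exact measure_preimage_affineSubspace_eq_zero μ (hE δ hδ)
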